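/- Let $a<b$, $u_0\in L^2((a,b))$, and for $u\in L^2((a,b))$ let $$J(u)=\sup\Big\{\int_a^b u\,v'\,dx:\ v\in C_c^\infty((a,b);[-1,1])\Big\}\in[0,\infty]$$ be the total variation of $u$. Then the one-dimensional total variation flow starting from $u_0$ exists, i.e. there is a solution $u\in C([0,\infty);L^2((a,b)))$ of the $L^2$-gradient flow of $J$: $u(0)=u_0$, $u$ is absolutely continuous on the compact subintervals of $(0,\infty)$, and for a.e. $t>0$ it is differentiable at $t$ with $-u'(t)\in\partial J(u(t))$, where $\partial J$ is the subdifferential of $J$ in $L^2((a,b))$. Moreover every such solution $u$ has the following properties. (i) For every $t>0$, $u(t)$ is the unique minimizer over $v\in L^2((a,b))$ of $$J(v)+\frac1{2t}\int_a^b|v-u_0|^2\,dx.$$ (ii) There exist sets $E^+(t),E^-(t)\subset(a,b)$, $t>0$, closed (in $\mathbb R$) and disjoint for every $t>0$ and nonincreasing in $t$ (that is, $E^\pm(t)\subseteq E^\pm(s)$ for $0<s\le t$), such that for every $t>0$: $u(t)=u_0$ a.e. on $E^+(t)\cup E^-(t)$; $u_0$ is (a.e. equal to) a nondecreasing function on any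 interval contained in $E^+(t)$ and a nonincreasing function on any interval contained in $E^-(t)$; and $u(t)$ is (a.e. equal to a) constant on each connected component of $(a,b)\setminus(E^+(t)\cup E^-(t))$. -/

import Mathlib

open MeasureTheory Set Filter Topology
open scoped ENNReal ContDiff

noncomputable section

/-- The Hilbert space `L²((a,b))` of (classes of) real functions. -/
abbrev L2Ioo (a b : ℝ) : Type := Lp ℝ 2 (volume.restrict (Ioo a b))

/-- Admissible test functions for the total variation: `v ∈ C_c^∞((a,b); [-1,1])`. -/
structure IsTVTest (a b : ℝ) (v : ℝ → ℝ) : Prop where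
  smooth : ContDiff ℝ ∞ v
  compact_support : HasCompactSupport v
  support_subset : tsupport v ⊆ Ioo a b
  abs_le_one : ∀ x, |v x| ≤ 1

/-- The total variation `J(u) = sup { ∫_a^b u v' : v ∈ C_c^∞((a,b); [-1,1]) } ∈ [0,∞]`.
The supremum is nonnegative (take `v = 0`), so truncating its members at `0` changes nothing. -/
def totalVar (a b : ℝ) (u : L2Ioo a b) : ℝ≥0∞ :=
  ⨆ (v : ℝ → ℝ) (_ : IsTVTest a b v), ENNReal.ofReal (∫ x in Ioo a b, u x * deriv v x)

/-- The subdifferential `∂J(u)` of the total variation in the Hilbert space `L²((a,b))`. -/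
def tvSubdiff (a b : ℝ) (u : L2Ioo a b) : Set (L2Ioo a b) :=
  {p | totalVar a b u ≠ ⊤ ∧ ∀ v : L2Ioo a b,
    (totalVar a b u : EReal) + ((inner ℝ p (v - u) : ℝ) : EReal) ≤ (totalVar a b v : EReal)}

/-- `u` is the (strong) solution on `[0,∞)` of the `L²`-gradient flow `u_t ∈ -∂J(u)`, `u(0) = u₀`
of the total variation: it is continuous on `[0,∞)` with values in `L²((a,b))`, absolutely
continuous on the compact subintervals of `(0,∞)`, and for a.e. `t > 0` it is differentiable at `t`
with `-u'(t) ∈ ∂J(u(t))`. The values of `u` at negative times are irrelevant. -/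
structure IsTVFlow (a b : ℝ) (u₀ : L2Ioo a b) (u : ℝ → L2Ioo a b) : Prop where
  initial : u 0 = u₀
  continuousOn : ContinuousOn u (Ici 0)
  absolutelyContinuous : ∀ s t : ℝ, 0 < s → s ≤ t → AbsolutelyContinuousOnInterval u s t
  evolution : ∀ᵐ t : ℝ, 0 < t → ∃ p : L2Ioo a b, HasDerivAt u p t ∧ -p ∈ tvSubdiff a b (u t)

/-- The functional `u ↦ J(u) + (1/(2t)) ∫_a^b |u - u₀|²` on `L²((a,b))`. -/
def tvEnergy (a b : ℝ) (u₀ : L2Ioo a b) (t : ℝ) (u : L2Ioo a b) : ℝ≥0∞ :=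
  totalVar a b u + ENNReal.ofReal (1 / (2 * t) * ∫ x in Ioo a b, |u x - u₀ x| ^ 2)

/-- `f` is nondecreasing on `I`, as a class of functions modulo null sets. -/
def AEMonotoneOn (f : ℝ → ℝ) (I : Set ℝ) : Prop :=
  ∃ g : ℝ → ℝ, MonotoneOn g I ∧ ∀ᵐ x ∂volume.restrict I, f x = g x

/-- `f` is nonincreasing on `I`, as a class of functions modulo null sets. -/
def AEAntitoneOn (f : ℝ → ℝ) (I : Set ℝ) : Prop :=
  ∃ g : ℝ → ℝ, AntitoneOn g I ∧ ∀ᵐ x ∂volume.restrict I, f x = g x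

end

noncomputable section

variable {a b : ℝ}

lemma LipschitzWith.comp_absolutelyContinuous {X Y : Type*} [PseudoMetricSpace X]
    [PseudoMetricSpace Y] {K : NNReal} {g : X → Y} (hg : LipschitzWith K g) {f : ℝ → X} {s t : ℝ}
    (hf : AbsolutelyContinuousOnInterval f s t) :
    AbsolutelyContinuousOnInterval (fun x => g (f x)) s t := by
  have h := Tendsto.const_mul (K : ℝ) hf
  rw [mul_zero] at h
  refine squeeze_zero (fun E => Finset.sum_nonneg fun _ _ => dist_nonneg) (fun E => ?_) h
  rw [Finset.mul_sum]
  exact Finset.sum_le_sum fun i _ => hg.dist_le_mul _ _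

/-- The extension by zero of (a representative of) a class in `L²((a,b))`. -/
def zeroExt (u : L2Ioo a b) : ℝ → ℝ := (Ioo a b).indicator u

/-- The primitive vanishing at `a` of the extension by zero. -/
def prim (u : L2Ioo a b) (x : ℝ) : ℝ := ∫ y in a..x, zeroExt u y

/-- The class of the indicator function of `(a, x]` in `L²((a,b))`. -/
def stepFn (a b x : ℝ) : L2Ioo a b :=
  indicatorConstLp 2 (measurableSet_Iic (a := x)) (measure_ne_top _ _) 1

lemma integrable_zeroExt (u : L2Ioo a b) : Integrable (zeroExt u) := by
  rw [zeroExt, integrable_indicator_iff measurableSet_Ioo]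
  exact (Lp.memLp u).integrable (by norm_num)

lemma ae_eq_of_zeroExt {f : ℝ → ℝ} {u : L2Ioo a b} (h : u =ᵐ[volume.restrict (Ioo a b)] f) :
    zeroExt u =ᵐ[volume] (Ioo a b).indicator f := by
  filter_upwards [(ae_restrict_iff' measurableSet_Ioo).1 h] with x hx
  by_cases hxI : x ∈ Ioo a b
  · simp [zeroExt, hxI, hx hxI]
  · simp [zeroExt, hxI]

lemma prim_eq_inner (u : L2Ioo a b) (x : ℝ) : prim u x = inner ℝ (stepFn a b x) u := by
  have h0 : ∫ y in Iic a, zeroExt u y = 0 := by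
    rw [setIntegral_congr_fun (g := fun _ => 0) measurableSet_Iic]
    · simp
    · intro y hy
      simp only [mem_Iic] at hy
      simp [zeroExt, hy.not_gt]
  have h1 := intervalIntegral.integral_Iic_sub_Iic (μ := volume) (a := a) (b := x)
    (integrable_zeroExt u).integrableOn (integrable_zeroExt u).integrableOn
  rw [prim, ← h1, h0, sub_zero, stepFn, L2.inner_indicatorConstLp_one,
    Measure.restrict_restrict measurableSet_Iic, zeroExt, setIntegral_indicator measurableSet_Ioo]

lemma prim_add (u v : L2Ioo a b) (x : ℝ) : prim (u + v) x = prim u x + prim v x := by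
  simp [prim_eq_inner, inner_add_right]

lemma prim_sub (u v : L2Ioo a b) (x : ℝ) : prim (u - v) x = prim u x - prim v x := by
  simp [prim_eq_inner, inner_sub_right]

lemma prim_neg (u : L2Ioo a b) (x : ℝ) : prim (-u) x = -prim u x := by
  simp [prim_eq_inner, inner_neg_right]

lemma prim_smul (c : ℝ) (u : L2Ioo a b) (x : ℝ) : prim (c • u) x = c * prim u x := by
  simp [prim_eq_inner, inner_smul_right]

lemma prim_zero (x : ℝ) : prim (0 : L2Ioo a b) x = 0 := by
  simp [prim_eq_inner]

lemma continuous_prim_left (x : ℝ) : Continuous fun u : L2Ioo a b => prim u x := by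
  simp only [prim_eq_inner]
  fun_prop

lemma continuous_prim (u : L2Ioo a b) : Continuous (prim u) :=
  intervalIntegral.continuous_primitive (fun _ _ => (integrable_zeroExt u).intervalIntegrable) a

lemma absolutelyContinuous_prim (u : L2Ioo a b) (x : ℝ) :
    AbsolutelyContinuousOnInterval (prim u) a x :=
  IntervalIntegrable.absolutelyContinuousOnInterval_intervalIntegral
    (integrable_zeroExt u).intervalIntegrable left_mem_uIcc

lemma ae_hasDerivAt_prim (u : L2Ioo a b) : ∀ᵐ x, HasDerivAt (prim u) (zeroExt u x) x := by
  filter_upwards [LocallyIntegrable.ae_hasDerivAt_integral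
    (integrable_zeroExt u).locallyIntegrable] with x hx
    using hx a

lemma prim_of_le (u : L2Ioo a b) {x : ℝ} (hx : x ≤ a) : prim u x = 0 := by
  rw [prim, intervalIntegral.integral_congr (g := fun _ => 0)]
  · simp
  · intro y hy
    rw [uIcc_of_ge hx] at hy
    simp [zeroExt, hy.2.not_gt]

lemma prim_of_ge (u : L2Ioo a b) {x : ℝ} (hx : b ≤ x) : prim u x = prim u b := by
  rw [← sub_eq_zero, prim, prim, intervalIntegral.integral_interval_sub_left
    (integrable_zeroExt u).intervalIntegrable (integrable_zeroExt u).intervalIntegrable,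
    intervalIntegral.integral_congr (g := fun _ => 0)]
  · simp
  · intro y hy
    rw [uIcc_of_le hx] at hy
    simp [zeroExt, hy.1.not_gt]

lemma zeroExt_toLp_ae {f : ℝ → ℝ} (hf : MemLp f 2 (volume.restrict (Ioo a b))) :
    zeroExt hf.toLp =ᵐ[volume] (Ioo a b).indicator f :=
  ae_eq_of_zeroExt hf.coeFn_toLp

lemma prim_toLp {f : ℝ → ℝ} (hf : MemLp f 2 (volume.restrict (Ioo a b))) (x : ℝ) :
    prim hf.toLp x = ∫ y in a..x, (Ioo a b).indicator f y :=
  intervalIntegral.integral_congr_ae ((zeroExt_toLp_ae hf).mono fun _ h _ => h)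

lemma eq_zero_of_prim_eq_zero {u : L2Ioo a b} (h : ∀ x, prim u x = 0) : u = 0 := by
  have h' : prim u = fun _ => 0 := funext h
  have : ∀ᵐ x, zeroExt u x = 0 := by
    filter_upwards [ae_hasDerivAt_prim u] with x hx
    rw [h'] at hx
    exact hx.unique (hasDerivAt_const x 0)
  rw [Lp.eq_zero_iff_ae_eq_zero]
  refine (ae_restrict_iff' measurableSet_Ioo).2 ?_
  filter_upwards [this] with x hx hxI
  simpa [zeroExt, hxI] using hx

lemma norm_stepFn_le (x : ℝ) : ‖stepFn a b x‖ ≤ ‖stepFn a b b‖ := by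
  rw [stepFn, stepFn, norm_indicatorConstLp (by norm_num) (by norm_num),
    norm_indicatorConstLp (by norm_num) (by norm_num)]
  gcongr 1
  refine Real.rpow_le_rpow measureReal_nonneg ?_ (by norm_num)
  rw [measureReal_restrict_apply measurableSet_Iic, measureReal_restrict_apply measurableSet_Iic]
  refine measureReal_mono (fun y hy => ⟨hy.2.2.le, hy.2⟩) ?_
  exact ((measure_mono inter_subset_right).trans_lt measure_Ioo_lt_top).ne

lemma abs_prim_le (u : L2Ioo a b) (x : ℝ) : |prim u x| ≤ ‖stepFn a b b‖ * ‖u‖ := by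
  rw [prim_eq_inner]
  exact (abs_real_inner_le_norm _ _).trans
    (mul_le_mul_of_nonneg_right (norm_stepFn_le x) (norm_nonneg _))

lemma prim_stepFn {c x : ℝ} (hc : c ∈ Icc a b) (hx : x ∈ Icc a b) :
    prim (stepFn a b c) x = min x c - a := by
  rw [prim_eq_inner, stepFn, stepFn, L2.real_inner_indicatorConstLp_one_indicatorConstLp_one,
    measureReal_restrict_apply (measurableSet_Iic.inter measurableSet_Iic),
    Iic_inter_Iic, min_comm x c]
  have h1 : a ≤ min c x := le_min hc.1 hx.1
  have h2 : (Iic (min c x) ∩ Ioo a b : Set ℝ) =ᵐ[volume] Ioc a (min c x) := by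
    have : min c x ≤ b := (min_le_left _ _).trans hc.2
    filter_upwards [compl_mem_ae_iff.2 (measure_singleton b)] with y hy
    have hy : y ≠ b := hy
    refine propext ⟨fun h => ⟨h.2.1, h.1⟩, fun h => ⟨h.2, h.1, lt_of_le_of_ne (h.2.trans this) hy⟩⟩
  rw [measureReal_congr h2, Real.volume_real_Ioc_of_le h1]

/-- The positive part of a primitive is the primitive of the truncated derivative. -/
lemma exists_prim_eq_max (p : L2Ioo a b) {c : ℝ} (hc : 0 ≤ c) :
    ∃ g : L2Ioo a b, (∀ x, prim g x = max (prim p x - c) 0) ∧ inner ℝ p g = ‖g‖ ^ 2 := by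
  have hS : MeasurableSet {x | 0 < prim p x - c} :=
    (isOpen_lt continuous_const ((continuous_prim p).sub continuous_const)).measurableSet
  set S := {x | 0 < prim p x - c}
  have hg : MemLp (S.indicator p) 2 (volume.restrict (Ioo a b)) := (Lp.memLp p).indicator hS
  refine ⟨hg.toLp, fun x => ?_, ?_⟩
  · rcases le_total x a with hx | hx
    · rw [prim_of_le _ hx, prim_of_le _ hx]
      simp [hc]
    · have hac : AbsolutelyContinuousOnInterval (fun x => max (prim p x - c) 0) a x :=
        ((LipschitzWith.id.sub (LipschitzWith.const c)).max_const 0).comp_absolutelyContinuous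
          (absolutelyContinuous_prim p x)
      have h1 := hac.integral_deriv_eq_sub
      rw [prim_of_le p le_rfl, zero_sub, max_eq_right (neg_nonpos.2 hc), sub_zero] at h1
      rw [← h1, prim_toLp]
      have hd := hac.ae_differentiableAt
      refine intervalIntegral.integral_congr_ae ?_
      filter_upwards [hd, ae_hasDerivAt_prim p] with y hy hy' hyx
      have hy := hy (uIoc_subset_uIcc hyx)
      have hcont : ContinuousAt (fun x => prim p x - c) y :=
        ((continuous_prim p).sub continuous_const).continuousAt
      by_cases h0 : 0 < prim p y - c
      · have : (fun x => max (prim p x - c) 0) =ᶠ[𝓝 y] fun x => prim p x - c := by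
          filter_upwards [hcont.eventually (lt_mem_nhds h0)] with z hz
          exact max_eq_left hz.le
        rw [this.deriv_eq, (hy'.sub_const c).deriv, zeroExt]
        by_cases hyI : y ∈ Ioo a b
        · have : y ∈ S := h0
          simp [hyI, this]
        · simp [hyI]
      · have hm : IsLocalMin (fun x => max (prim p x - c) 0) y := by
          refine Eventually.of_forall fun z => ?_
          simp only [max_eq_right (not_lt.1 h0)]
          exact le_max_right _ _
        rw [hm.deriv_eq_zero]
        have : y ∉ S := h0
        simp [indicator_apply, this]
  · rw [← real_inner_self_eq_norm_sq, L2.inner_def, L2.inner_def]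
    refine integral_congr_ae ?_
    filter_upwards [hg.coeFn_toLp] with y hy
    rw [hy]
    by_cases h : y ∈ S <;> simp [h]

lemma ae_eq_zero_of_abs_prim_eq {p : L2Ioo a b} {c : ℝ} (h : ∀ x, |prim p x| ≤ c) :
    ∀ᵐ x, |prim p x| = c → zeroExt p x = 0 := by
  filter_upwards [ae_hasDerivAt_prim p] with x hx hxc
  rcases eq_or_eq_neg_of_abs_eq hxc with h1 | h1
  · refine IsLocalMax.hasDerivAt_eq_zero (Eventually.of_forall fun y => ?_) hx
    rw [h1]
    exact (abs_le.1 (h y)).2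
  · refine IsLocalMin.hasDerivAt_eq_zero (Eventually.of_forall fun y => ?_) hx
    rw [h1]
    exact (abs_le.1 (h y)).1

/-- The derivatives of the functions of `H¹₀((a,b))` that are bounded by `c` in absolute value. -/
def tvBall (a b c : ℝ) : Set (L2Ioo a b) := {p | prim p b = 0 ∧ ∀ x, |prim p x| ≤ c}

lemma isClosed_tvBall (c : ℝ) : IsClosed (tvBall a b c) := by
  simp only [tvBall, ofPred_and, ofPred_forall]
  exact (isClosed_eq (continuous_prim_left b) continuous_const).inter
    (isClosed_iInter fun x => isClosed_le (continuous_prim_left x).abs continuous_const)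

lemma smul_mem_tvBall {p : L2Ioo a b} {c d : ℝ} (hd : 0 ≤ d) (hp : p ∈ tvBall a b c) :
    d • p ∈ tvBall a b (d * c) := by
  refine ⟨by rw [prim_smul, hp.1, mul_zero], fun x => ?_⟩
  rw [prim_smul, abs_mul, abs_of_nonneg hd]
  exact mul_le_mul_of_nonneg_left (hp.2 x) hd

lemma add_mem_tvBall {p q : L2Ioo a b} {c d : ℝ} (hp : p ∈ tvBall a b c) (hq : q ∈ tvBall a b d) :
    p + q ∈ tvBall a b (c + d) := by
  refine ⟨by rw [prim_add, hp.1, hq.1, add_zero], fun x => ?_⟩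
  rw [prim_add]
  exact (abs_add_le _ _).trans (add_le_add (hp.2 x) (hq.2 x))

lemma convex_tvBall (c : ℝ) : Convex ℝ (tvBall a b c) := by
  intro p hp q hq s t hs ht hst
  have := add_mem_tvBall (smul_mem_tvBall hs hp) (smul_mem_tvBall ht hq)
  rwa [← add_mul, hst, one_mul] at this

lemma zero_mem_tvBall {c : ℝ} (hc : 0 ≤ c) : (0 : L2Ioo a b) ∈ tvBall a b c :=
  ⟨prim_zero b, fun x => by rwa [prim_zero, abs_zero]⟩

/-- The classes of smooth functions with compact support in `(a,b)`. -/
def smoothClasses (a b : ℝ) : Submodule ℝ (L2Ioo a b) where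
  carrier := {f | ∃ φ : ℝ → ℝ, ContDiff ℝ ∞ φ ∧ HasCompactSupport φ ∧ tsupport φ ⊆ Ioo a b ∧
    f =ᵐ[volume.restrict (Ioo a b)] φ}
  zero_mem' := ⟨0, contDiff_const, HasCompactSupport.zero, by simp [tsupport], Lp.coeFn_zero _ _ _⟩
  add_mem' := by
    rintro f g ⟨φ, h1, h2, h3, h4⟩ ⟨ψ, k1, k2, k3, k4⟩
    exact ⟨φ + ψ, h1.add k1, h2.add k2, (tsupport_add φ ψ).trans (union_subset h3 k3),
      (Lp.coeFn_add f g).trans (h4.add k4)⟩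
  smul_mem' := by
    rintro c f ⟨φ, h1, h2, h3, h4⟩
    refine ⟨c • φ, h1.const_smul c, h2.smul_left (f := fun _ => c),
      (tsupport_smul_subset_right (fun _ => c) φ).trans h3,
      (Lp.coeFn_smul c f).trans (h4.const_smul c)⟩

lemma memLp_of_smooth {φ : ℝ → ℝ} (h : Continuous φ) (h' : HasCompactSupport φ) :
    MemLp φ 2 (volume.restrict (Ioo a b)) :=
  (h.memLp_of_hasCompactSupport h').restrict _

lemma dense_smoothClasses : Dense (smoothClasses a b : Set (L2Ioo a b)) := by
  rw [Submodule.dense_iff_topologicalClosure_eq_top, Submodule.topologicalClosure_eq_top_iff,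
    Submodule.eq_bot_iff]
  intro u hu
  rw [Lp.eq_zero_iff_ae_eq_zero]
  refine (ae_restrict_iff' measurableSet_Ioo).2 ?_
  refine isOpen_Ioo.ae_eq_zero_of_integral_contDiff_smul_eq_zero ?_ fun φ h1 h2 h3 => ?_
  · exact IntegrableOn.locallyIntegrableOn ((Lp.memLp u).integrable (by norm_num))
  · have hm := memLp_of_smooth (a := a) (b := b) h1.continuous h2
    have h4 := hu hm.toLp ⟨φ, h1, h2, h3, hm.coeFn_toLp⟩
    rw [L2.inner_def] at h4
    rw [← setIntegral_eq_integral_of_forall_compl_eq_zero (s := Ioo a b), ← h4]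
    · refine integral_congr_ae ?_
      filter_upwards [hm.coeFn_toLp] with x hx
      rw [hx]
      simp [mul_comm]
    · intro x hx
      rw [image_eq_zero_of_notMem_tsupport fun h => hx (h3 h), zero_smul]

lemma exists_Icc_of_isCompact (hab : a < b) {K : Set ℝ} (hK : IsCompact K) (h : K ⊆ Ioo a b) :
    ∃ c d, a < c ∧ c ≤ d ∧ d < b ∧ K ⊆ Icc c d := by
  rcases K.eq_empty_or_nonempty with rfl | hne
  · exact ⟨(a + b) / 2, (a + b) / 2, by linarith, le_rfl, by linarith, empty_subset _⟩
  · exact ⟨sInf K, sSup K, (h (hK.sInf_mem hne)).1, hK.isLeast_sInf hne |>.2 (hK.sSup_mem hne),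
      (h (hK.sSup_mem hne)).2, fun x hx => ⟨(hK.isLeast_sInf hne).2 hx, (hK.isGreatest_sSup hne).2 hx⟩⟩

/-- A smooth class of mean zero is the derivative of a smooth function compactly supported in
`(a,b)`, namely of its primitive. -/
lemma prim_smooth (hab : a < b) {f : L2Ioo a b} (hf : f ∈ smoothClasses a b) (h0 : prim f b = 0) :
    ContDiff ℝ ∞ (prim f) ∧ HasCompactSupport (prim f) ∧ tsupport (prim f) ⊆ Ioo a b ∧
      f =ᵐ[volume.restrict (Ioo a b)] deriv (prim f) := by
  obtain ⟨φ, h1, h2, h3, h4⟩ := hf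
  have hz : ∀ x, x ∉ tsupport φ → φ x = 0 := fun x hx => image_eq_zero_of_notMem_tsupport hx
  have hind : (Ioo a b).indicator φ = φ := by
    refine indicator_eq_self.2 fun x hx => h3 (subset_tsupport φ hx)
  have hp : prim f = fun x => ∫ y in a..x, φ y := by
    funext x
    refine intervalIntegral.integral_congr_ae ?_
    filter_upwards [ae_eq_of_zeroExt h4] with y hy _
    rw [hy, hind]
  have hd : ∀ x, HasDerivAt (prim f) (φ x) x := fun x => by
    rw [hp]
    exact intervalIntegral.integral_hasDerivAt_right (h1.continuous.intervalIntegrable _ _)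
      (h1.continuous.stronglyMeasurableAtFilter _ _) h1.continuous.continuousAt
  have hd' : deriv (prim f) = φ := funext fun x => (hd x).deriv
  obtain ⟨c, d, hc, hcd, hdb, hK⟩ := exists_Icc_of_isCompact hab h2 h3
  have hsub : tsupport (prim f) ⊆ Icc c d := by
    refine closure_minimal ?_ isClosed_Icc
    intro x hx
    by_contra hxn
    apply hx
    rw [mem_Icc, not_and_or, not_le, not_le] at hxn
    rcases hxn with hxc | hxd
    · rw [hp]
      refine (intervalIntegral.integral_congr (g := fun _ => 0) fun y hy => ?_).trans (by simp)
      refine hz y fun hy' => ?_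
      have := (hK hy').1
      exact absurd (hy.2.trans_lt (max_lt hc hxc)) this.not_gt
    · rw [← h0, ← sub_eq_zero, hp]
      dsimp only
      rw [intervalIntegral.integral_interval_sub_left
        (h1.continuous.intervalIntegrable _ _) (h1.continuous.intervalIntegrable _ _)]
      refine (intervalIntegral.integral_congr (g := fun _ => 0) fun y hy => ?_).trans (by simp)
      refine hz y fun hy' => ?_
      exact absurd ((lt_min hdb hxd).trans_le hy.1) (hK hy').2.not_gt
  refine ⟨contDiff_infty_iff_deriv.2 ⟨fun x => (hd x).differentiableAt, by rwa [hd']⟩,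
    HasCompactSupport.of_support_subset_isCompact isCompact_Icc ((subset_tsupport _).trans hsub),
    hsub.trans fun x hx => ⟨hc.trans_le hx.1, hx.2.trans_lt hdb⟩, by rwa [hd']⟩

lemma exists_smoothClass_prim_eq_one (hab : a < b) : ∃ f ∈ smoothClasses a b, prim f b = 1 := by
  have h : ∃ f ∈ smoothClasses a b, prim f b ≠ 0 := by
    by_contra! h
    have : EqOn (fun f : L2Ioo a b => prim f b) (fun _ => 0) (smoothClasses a b) := fun f hf => h f hf
    have := congr_fun (Continuous.ext_on dense_smoothClasses (continuous_prim_left b)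
      continuous_const this) (stepFn a b b)
    have hb : b ∈ Icc a b := right_mem_Icc.2 hab.le
    rw [prim_stepFn hb hb, min_self] at this
    linarith
  obtain ⟨f, hf, hne⟩ := h
  exact ⟨(prim f b)⁻¹ • f, Submodule.smul_mem _ _ hf, by rw [prim_smul, inv_mul_cancel₀ hne]⟩

lemma mem_closure_smoothClasses_mean_zero (hab : a < b) {p : L2Ioo a b} (hp : prim p b = 0) :
    p ∈ closure {f | f ∈ smoothClasses a b ∧ prim f b = 0} := by
  obtain ⟨η, hη, hη1⟩ := exists_smoothClass_prim_eq_one hab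
  have hT : Continuous fun f : L2Ioo a b => f - prim f b • η :=
    continuous_id.sub ((continuous_prim_left b).smul continuous_const)
  have h := map_mem_closure hT (dense_smoothClasses p)
    (t := {f | f ∈ smoothClasses a b ∧ prim f b = 0}) fun f hf =>
      ⟨Submodule.sub_mem _ hf (Submodule.smul_mem _ _ hη), by
        rw [prim_sub, prim_smul, hη1, mul_one, sub_self]⟩
  simpa [hp] using h

lemma inner_eq_integral_of_ae {u f : L2Ioo a b} {φ : ℝ → ℝ}
    (h : f =ᵐ[volume.restrict (Ioo a b)] φ) : inner ℝ u f = ∫ x in Ioo a b, u x * φ x := by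
  rw [L2.inner_def]
  refine integral_congr_ae ?_
  filter_upwards [h] with x hx
  rw [hx]
  simp [mul_comm]

lemma inner_le_of_forall_test (hab : a < b) {u : L2Ioo a b} {S : ℝ}
    (h : ∀ v, IsTVTest a b v → ∫ x in Ioo a b, u x * deriv v x ≤ S) {p : L2Ioo a b}
    (hp : p ∈ tvBall a b 1) : inner ℝ u p ≤ S := by
  set M := ‖stepFn a b b‖
  have hM : 0 ≤ M := norm_nonneg _
  have hcl : IsClosed {q : L2Ioo a b | inner ℝ u q ≤ S * (1 + M * ‖q - p‖)} :=
    isClosed_le (by fun_prop) (by fun_prop)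
  have hsub : {f | f ∈ smoothClasses a b ∧ prim f b = 0} ⊆
      {q : L2Ioo a b | inner ℝ u q ≤ S * (1 + M * ‖q - p‖)} := by
    rintro f ⟨hf, hf0⟩
    obtain ⟨h1, h2, h3, h4⟩ := prim_smooth hab hf hf0
    set r := 1 + M * ‖f - p‖
    have hr : 0 < r := by positivity
    have hb : ∀ x, |prim f x| ≤ r := fun x => by
      have e : prim f x = prim p x + prim (f - p) x := by rw [prim_sub]; ring
      rw [e]
      exact (abs_add_le _ _).trans (add_le_add (hp.2 x) (abs_prim_le _ x))
    have ht : IsTVTest a b (r⁻¹ • prim f) :=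
      ⟨contDiff_const.smul h1, h2.smul_left (f := fun _ => r⁻¹),
        (tsupport_smul_subset_right (fun _ => r⁻¹) _).trans h3, fun x => by
          rw [Pi.smul_apply, smul_eq_mul, abs_mul, abs_of_pos (inv_pos.2 hr), inv_mul_le_one₀ hr]
          exact hb x⟩
    have h5 := h _ ht
    have h6 : inner ℝ u (r⁻¹ • f) = ∫ x in Ioo a b, u x * deriv (r⁻¹ • prim f) x := by
      refine inner_eq_integral_of_ae ?_
      filter_upwards [h4, Lp.coeFn_smul r⁻¹ f] with x hx hx'
      rw [hx', Pi.smul_apply, hx, deriv_const_smul _ (h1.differentiable (by simp)).differentiableAt]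
    rw [← h6, inner_smul_right, inv_mul_le_iff₀ hr, mul_comm] at h5
    exact h5
  have := closure_minimal hsub hcl (mem_closure_smoothClasses_mean_zero hab hp.1)
  simpa using this

lemma ofReal_inner_le_totalVar (hab : a < b) (u : L2Ioo a b) {p : L2Ioo a b}
    (hp : p ∈ tvBall a b 1) : ENNReal.ofReal (inner ℝ u p) ≤ totalVar a b u := by
  by_cases hT : totalVar a b u = ⊤
  · simp [hT]
  refine ENNReal.ofReal_le_of_le_toReal (inner_le_of_forall_test hab (fun v hv => ?_) hp)
  rw [← ENNReal.ofReal_le_iff_le_toReal hT]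
  exact le_iSup₂ (f := fun v (_ : IsTVTest a b v) =>
    ENNReal.ofReal (∫ x in Ioo a b, u x * deriv v x)) v hv

lemma totalVar_le (u : L2Ioo a b) {S : ℝ} (h : ∀ p ∈ tvBall a b 1, inner ℝ u p ≤ S) :
    totalVar a b u ≤ ENNReal.ofReal S := by
  refine iSup₂_le fun v hv => ENNReal.ofReal_le_ofReal ?_
  have hc : Continuous (deriv v) := hv.smooth.continuous_deriv (by simp)
  have hm := memLp_of_smooth (a := a) (b := b) hc hv.compact_support.deriv
  have hz : ∀ x, x ∉ Ioo a b → v x = 0 := fun x hx =>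
    image_eq_zero_of_notMem_tsupport fun h => hx (hv.support_subset h)
  have hind : (Ioo a b).indicator (deriv v) = deriv v :=
    indicator_eq_self.2 fun x hx => hv.support_subset (support_deriv_subset hx)
  have hprim : ∀ x, prim hm.toLp x = v x := fun x => by
    rw [prim_toLp, hind, intervalIntegral.integral_deriv_eq_sub
      (fun y _ => (hv.smooth.differentiable (by simp)).differentiableAt)
      (hc.intervalIntegrable _ _), hz a (by simp), sub_zero]
  rw [← inner_eq_integral_of_ae hm.coeFn_toLp]
  refine h _ ⟨by rw [hprim, hz b (by simp)], fun x => ?_⟩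
  rw [hprim]
  exact hv.abs_le_one x

section Hilbert

variable {H : Type*} [NormedAddCommGroup H] [InnerProductSpace ℝ H]

/-- The elements of `K` at which the linear functional `⟪x, ·⟫` attains its maximum over `K`. -/
def normalFace (K : Set H) (x : H) : Set H := {p ∈ K | ∀ q ∈ K, inner ℝ x q ≤ inner ℝ x p}

lemma normalFace_monotone {K : Set H} {x y p q : H} (hp : p ∈ normalFace K x)
    (hq : q ∈ normalFace K y) : 0 ≤ inner ℝ (p - q) (x - y) := by
  have h1 := hp.2 q hq.1
  have h2 := hq.2 p hp.1
  rw [inner_sub_left, inner_sub_right, inner_sub_right, real_inner_comm x, real_inner_comm x,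
    real_inner_comm y, real_inner_comm y]
  linarith

lemma isClosed_normalFace {K : Set H} (hK : IsClosed K) (x : H) : IsClosed (normalFace K x) := by
  simp only [normalFace, ofPred_and, ofPred_forall]
  exact hK.inter (isClosed_iInter fun q => isClosed_iInter fun _ =>
    isClosed_le continuous_const (by fun_prop))

lemma convex_normalFace {K : Set H} (hK : Convex ℝ K) (x : H) : Convex ℝ (normalFace K x) := by
  intro p hp q hq s t hs ht hst
  refine ⟨hK hp.1 hq.1 hs ht hst, fun r hr => ?_⟩
  rw [inner_add_right, inner_smul_right, inner_smul_right]
  have h1 := mul_le_mul_of_nonneg_left (hp.2 r hr) hs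
  have h2 := mul_le_mul_of_nonneg_left (hq.2 r hr) ht
  have : inner ℝ x r = s * inner ℝ x r + t * inner ℝ x r := by rw [← add_mul, hst, one_mul]
  linarith

/-- Two evolutions by a monotone operator with the same initial value agree. -/
lemma eq_of_monotone_evolution {A : H → Set H}
    (hA : ∀ x y, ∀ p ∈ A x, ∀ q ∈ A y, 0 ≤ inner ℝ (p - q) (x - y)) {u v : ℝ → H}
    (h0 : u 0 = v 0) (hu : ContinuousOn u (Ici 0)) (hv : ContinuousOn v (Ici 0))
    (hu' : ∀ s t : ℝ, 0 < s → s ≤ t → AbsolutelyContinuousOnInterval u s t)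
    (hv' : ∀ s t : ℝ, 0 < s → s ≤ t → AbsolutelyContinuousOnInterval v s t)
    (hue : ∀ᵐ t : ℝ, 0 < t → ∃ p, HasDerivAt u p t ∧ -p ∈ A (u t))
    (hve : ∀ᵐ t : ℝ, 0 < t → ∃ p, HasDerivAt v p t ∧ -p ∈ A (v t)) {t : ℝ} (ht : 0 ≤ t) :
    u t = v t := by
  have hmono : ∀ s, 0 < s → s ≤ t → ‖u t - v t‖ * ‖u t - v t‖ ≤ ‖u s - v s‖ * ‖u s - v s‖ := by
    intro s hs hst
    have hn : AbsolutelyContinuousOnInterval (fun x => ‖(u - v) x‖) s t :=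
      lipschitzWith_one_norm.comp_absolutelyContinuous ((hu' s t hs hst).sub (hv' s t hs hst))
    have h1 := (hn.mul hn).integral_deriv_eq_sub
    simp only [Pi.mul_apply, Pi.sub_apply] at h1
    rw [← sub_nonpos, ← h1]
    rw [← neg_nonneg, ← intervalIntegral.integral_neg]
    refine intervalIntegral.integral_nonneg_of_ae_restrict hst ?_
    refine (ae_restrict_iff' measurableSet_Icc).2 ?_
    filter_upwards [hue, hve] with x hx hx' hxI
    have hx0 := hs.trans_le hxI.1
    obtain ⟨p, hp, hpA⟩ := hx hx0
    obtain ⟨q, hq, hqA⟩ := hx' hx0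
    have h2 := (hp.sub hq).norm_sq
    have h3 : ((fun x => ‖u x - v x‖) * fun x => ‖u x - v x‖) = fun x => ‖(u - v) x‖ ^ 2 := by
      funext x
      simp [sq]
    rw [h3, h2.deriv]
    have h4 := hA _ _ _ hpA _ hqA
    rw [← neg_sub', inner_neg_left, real_inner_comm] at h4
    simp only [Pi.zero_apply, Pi.sub_apply]
    linarith
  have hc : Tendsto (fun s => ‖u s - v s‖ * ‖u s - v s‖) (𝓝[>] 0) (𝓝 0) := by
    have h1 : ContinuousWithinAt (fun s => ‖u s - v s‖ * ‖u s - v s‖) (Ici 0) 0 :=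
      (((hu.sub hv).norm).mul ((hu.sub hv).norm)) 0 self_mem_Ici
    have h2 := h1.tendsto
    simp only [h0, sub_self, norm_zero, mul_zero] at h2
    exact h2.mono_left (nhdsWithin_mono _ Ioi_subset_Ici_self)
  rcases ht.eq_or_lt with rfl | ht
  · exact h0
  have h1 : ‖u t - v t‖ * ‖u t - v t‖ ≤ 0 := by
    refine ge_of_tendsto hc ?_
    filter_upwards [Ioo_mem_nhdsGT ht] with s hs using hmono s hs.1 hs.2.le
  rw [← sub_eq_zero, ← norm_eq_zero]
  nlinarith [norm_nonneg (u t - v t)]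

/-- A closed convex nonempty set has an element of minimal norm. -/
lemma exists_minimal_norm [CompleteSpace H] {K : Set H} (hne : K.Nonempty) (hc : IsClosed K)
    (hK : Convex ℝ K) : ∃ q ∈ K, ∀ p ∈ K, ‖q‖ ^ 2 ≤ inner ℝ q p := by
  obtain ⟨q, hq, h⟩ := exists_norm_eq_iInf_of_complete_convex hne hc.isComplete hK 0
  refine ⟨q, hq, fun p hp => ?_⟩
  have := (norm_eq_iInf_iff_real_inner_le_zero hK hq).1 h p hp
  rw [zero_sub, inner_neg_left, inner_sub_right, real_inner_self_eq_norm_sq] at this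
  linarith

lemma norm_sub_sq_le_of_sq_le_inner {p q : H} (h : ‖q‖ ^ 2 ≤ inner ℝ q p) :
    ‖p - q‖ ^ 2 ≤ ‖p‖ ^ 2 - ‖q‖ ^ 2 := by
  rw [norm_sub_sq_real, real_inner_comm]
  linarith

lemma norm_le_of_sq_le_inner {p q : H} (h : ‖q‖ ^ 2 ≤ inner ℝ q p) : ‖q‖ ≤ ‖p‖ := by
  have := (norm_sub_sq_le_of_sq_le_inner h).trans' (sq_nonneg _)
  exact le_of_sq_le_sq (by linarith) (norm_nonneg _)

variable [CompleteSpace H]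

/-- Let `A` be a monotone operator with closed convex values. If the difference quotients of `u`
satisfy the implicit Euler inclusion for `-A` at all scales, then `u` solves `u' ∈ -A u`. -/
theorem evolution_of_implicit_euler {A : H → Set H}
    (hA : ∀ x y, ∀ p ∈ A x, ∀ q ∈ A y, 0 ≤ inner ℝ (p - q) (x - y))
    (hcl : ∀ x, IsClosed (A x)) (hcv : ∀ x, Convex ℝ (A x)) {u : ℝ → H}
    (hu : ∀ s t, 0 ≤ s → s < t → (t - s)⁻¹ • (u s - u t) ∈ A (u t)) :
    (∀ s t : ℝ, 0 < s → s ≤ t → AbsolutelyContinuousOnInterval u s t) ∧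
      ContinuousOn u (Ioi 0) ∧
      ∀ᵐ t : ℝ, 0 < t → ∃ p, HasDerivAt u p t ∧ -p ∈ A (u t) := by
  have hmin : ∀ t : ℝ, ∃ q : H, 0 < t → q ∈ A (u t) ∧ ∀ p ∈ A (u t), ‖q‖ ^ 2 ≤ inner ℝ q p := by
    intro t
    by_cases ht : 0 < t
    · obtain ⟨q, hq⟩ := exists_minimal_norm ⟨_, hu 0 t le_rfl ht⟩ (hcl (u t)) (hcv (u t))
      exact ⟨q, fun _ => hq⟩
    · exact ⟨0, fun h => absurd h ht⟩
  choose q hq using hmin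
  have hle : ∀ s t, 0 < s → s < t →
      ‖(t - s)⁻¹ • (u s - u t)‖ ^ 2 ≤ inner ℝ ((t - s)⁻¹ • (u s - u t)) (q s) := by
    intro s t hs hst
    set p := (t - s)⁻¹ • (u s - u t)
    have hts : 0 < t - s := sub_pos.2 hst
    have h1 : 0 ≤ inner ℝ (q s - p) (u s - u t) := hA _ _ _ (hq s hs).1 _ (hu s t hs.le hst)
    have h2 : u s - u t = (t - s) • p := by rw [smul_inv_smul₀ hts.ne']
    rw [h2, inner_smul_right] at h1
    have h3 := nonneg_of_mul_nonneg_right h1 hts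
    rw [inner_sub_left, real_inner_self_eq_norm_sq, real_inner_comm] at h3
    linarith
  have hge : ∀ s t, 0 ≤ s → s < t →
      ‖q t‖ ^ 2 ≤ inner ℝ (q t) ((t - s)⁻¹ • (u s - u t)) := fun s t hs hst =>
    (hq t (hs.trans_lt hst)).2 _ (hu s t hs hst)
  have hanti : AntitoneOn (fun t => ‖q t‖ ^ 2) (Ioi 0) := by
    intro s hs t _ hst
    rcases hst.eq_or_lt with rfl | hst
    · exact le_rfl
    · have h1 := norm_le_of_sq_le_inner (hge s t (le_of_lt hs) hst)
      have h2 := norm_le_of_sq_le_inner (hle s t hs hst)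
      exact pow_le_pow_left₀ (norm_nonneg _) (h1.trans h2) 2
  have hlip : ∀ s, 0 < s → LipschitzOnWith ‖q s‖₊ u (Ici s) := by
    intro s hs
    have key : ∀ x ∈ Ici s, ∀ y ∈ Ici s, x < y → dist (u x) (u y) ≤ ‖q s‖₊ * dist x y := by
      intro x hx y hy hxy
      have hx0 : 0 < x := hs.trans_le hx
      have h1 := norm_le_of_sq_le_inner (hle x y hx0 hxy)
      have h2 : ‖q x‖ ≤ ‖q s‖ := le_of_sq_le_sq (hanti hs hx0 hx) (norm_nonneg _)
      have hyx : 0 < y - x := sub_pos.2 hxy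
      rw [norm_smul, norm_inv, Real.norm_of_nonneg hyx.le, inv_mul_le_iff₀ hyx] at h1
      rw [dist_eq_norm, dist_comm, Real.dist_eq, abs_of_pos hyx, coe_nnnorm, mul_comm]
      exact h1.trans (mul_le_mul_of_nonneg_left h2 hyx.le)
    refine LipschitzOnWith.of_dist_le_mul fun x hx y hy => ?_
    rcases lt_trichotomy x y with h | rfl | h
    · exact key x hx y hy h
    · simp
    · rw [dist_comm, dist_comm x]
      exact key y hy x hx h
  refine ⟨fun s t hs hst => ?_, fun t ht => ?_, ?_⟩
  · refine ((hlip s hs).mono ?_).absolutelyContinuousOnInterval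
    rw [uIcc_of_le hst]
    exact Icc_subset_Ici_self
  · have ht : 0 < t := ht
    exact ((hlip (t / 2) (half_pos ht)).continuousOn.continuousAt
      (Ici_mem_nhds (half_lt_self ht))).continuousWithinAt
  · filter_upwards [hanti.countable_not_continuousWithinAt.ae_notMem volume] with t ht ht0
    have hcont : ContinuousAt (fun t => ‖q t‖ ^ 2) t := by
      by_contra h
      exact ht ⟨ht0, fun h' => h (h'.continuousAt (Ioi_mem_nhds ht0))⟩
    refine ⟨-q t, ?_, by rw [neg_neg]; exact (hq t ht0).1⟩
    have hlim : Tendsto (fun s => |‖q t‖ ^ 2 - ‖q s‖ ^ 2|) (𝓝 t) (𝓝 0) := by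
      have := (tendsto_const_nhds (x := ‖q t‖ ^ 2)).sub hcont.tendsto
      simpa using this.abs
    have hbound : ∀ s, 0 < s → s ≠ t → ‖slope u t s - -q t‖ ^ 2 ≤ |‖q t‖ ^ 2 - ‖q s‖ ^ 2| := by
      intro s hs hst
      rcases hst.lt_or_gt with hst | hst
      · have h1 := norm_sub_sq_le_of_sq_le_inner (hge s t hs.le hst)
        have h2 := norm_le_of_sq_le_inner (hle s t hs hst)
        have h3 := pow_le_pow_left₀ (norm_nonneg _) h2 2
        have e : slope u t s - -q t = -((t - s)⁻¹ • (u s - u t) - q t) := by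
          rw [slope_def_module, ← neg_sub t s, inv_neg, neg_smul]
          abel
        rw [e, norm_neg, abs_sub_comm]
        exact (h1.trans (by linarith)).trans (le_abs_self _)
      · have h1 := norm_sub_sq_le_of_sq_le_inner (hle t s ht0 hst)
        have h2 := norm_le_of_sq_le_inner (hge t s ht0.le hst)
        have h3 := pow_le_pow_left₀ (norm_nonneg _) h2 2
        have e : slope u t s - -q t = q t - (s - t)⁻¹ • (u t - u s) := by
          rw [slope_def_module, ← neg_sub (u s) (u t), smul_neg]
          abel
        rw [e]
        exact (h1.trans (by linarith)).trans (le_abs_self _)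
    rw [hasDerivAt_iff_tendsto_slope, tendsto_iff_norm_sub_tendsto_zero]
    have hsq : Tendsto (fun s => ‖slope u t s - -q t‖ ^ 2) (𝓝[≠] t) (𝓝 0) := by
      refine squeeze_zero' (Eventually.of_forall fun _ => sq_nonneg _) ?_
        (hlim.mono_left nhdsWithin_le_nhds)
      filter_upwards [self_mem_nhdsWithin, nhdsWithin_le_nhds (Ioi_mem_nhds ht0)] with s hs hs0
        using hbound s hs0 hs
    have := hsq.sqrt
    simpa [Real.sqrt_sq (norm_nonneg _)] using this

end Hilbert

lemma totalVar_eq_of_mem_normalFace (hab : a < b) {u p : L2Ioo a b}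
    (hp : p ∈ normalFace (tvBall a b 1) u) : totalVar a b u = ENNReal.ofReal (inner ℝ u p) :=
  le_antisymm (totalVar_le u hp.2) (ofReal_inner_le_totalVar hab u hp.1)

lemma inner_nonneg_of_mem_normalFace {u p : L2Ioo a b} {c : ℝ} (hc : 0 ≤ c)
    (hp : p ∈ normalFace (tvBall a b c) u) : 0 ≤ inner ℝ u p := by
  simpa using hp.2 0 (zero_mem_tvBall hc)

lemma normalFace_subset_tvSubdiff (hab : a < b) (u : L2Ioo a b) :
    normalFace (tvBall a b 1) u ⊆ tvSubdiff a b u := by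
  intro p hp
  have hJ := totalVar_eq_of_mem_normalFace hab hp
  have h0 := inner_nonneg_of_mem_normalFace zero_le_one hp
  refine ⟨by simp [hJ], fun v => ?_⟩
  refine le_trans ?_ (EReal.coe_ennreal_le_coe_ennreal_iff.2 (ofReal_inner_le_totalVar hab v hp.1))
  rw [hJ, EReal.coe_ennreal_ofReal, EReal.coe_ennreal_ofReal, max_eq_left h0, ← EReal.coe_add,
    EReal.coe_le_coe_iff, inner_sub_right, real_inner_comm p u, real_inner_comm p v]
  exact le_max_of_le_left (by linarith)

lemma tvSubdiff_monotone (x y p : L2Ioo a b) (hp : p ∈ tvSubdiff a b x) (q : L2Ioo a b)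
    (hq : q ∈ tvSubdiff a b y) : 0 ≤ inner ℝ (p - q) (x - y) := by
  have h1 := hp.2 y
  have h2 := hq.2 x
  rw [← ENNReal.ofReal_toReal hp.1, ← ENNReal.ofReal_toReal hq.1, EReal.coe_ennreal_ofReal,
    EReal.coe_ennreal_ofReal, max_eq_left ENNReal.toReal_nonneg,
    max_eq_left ENNReal.toReal_nonneg, ← EReal.coe_add, EReal.coe_le_coe_iff,
    inner_sub_right] at h1 h2
  rw [inner_sub_left, inner_sub_right, inner_sub_right]
  linarith

lemma neg_mem_tvBall {p : L2Ioo a b} {c : ℝ} (hp : p ∈ tvBall a b c) : -p ∈ tvBall a b c :=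
  ⟨by rw [prim_neg, hp.1, neg_zero], fun x => by rw [prim_neg, abs_neg]; exact hp.2 x⟩

lemma neg_mem_normalFace {u p : L2Ioo a b} {c : ℝ} (hp : p ∈ normalFace (tvBall a b c) u) :
    -p ∈ normalFace (tvBall a b c) (-u) := by
  refine ⟨neg_mem_tvBall hp.1, fun q hq => ?_⟩
  have := hp.2 _ (neg_mem_tvBall hq)
  rw [inner_neg_right] at this
  rw [inner_neg_neg, inner_neg_left]
  exact this

lemma exists_mem_normalFace_sub (u₀ : L2Ioo a b) {t : ℝ} (ht : 0 ≤ t) :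
    ∃ p, p ∈ normalFace (tvBall a b t) (u₀ - p) := by
  obtain ⟨p, hp, h⟩ := exists_norm_eq_iInf_of_complete_convex ⟨0, zero_mem_tvBall ht⟩
    (isClosed_tvBall (a := a) (b := b) t).isComplete (convex_tvBall t) u₀
  refine ⟨p, hp, fun q hq => ?_⟩
  have := (norm_eq_iInf_iff_real_inner_le_zero (convex_tvBall t) hp).1 h q hq
  rw [inner_sub_right] at this
  linarith

/-- Comparison principle for the dual problems with constraints `s ≤ t`. -/
lemma prim_le_prim_add {u₀ p q : L2Ioo a b} {s t : ℝ} (hst : s ≤ t)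
    (hp : p ∈ normalFace (tvBall a b t) (u₀ - p)) (hq : q ∈ normalFace (tvBall a b s) (u₀ - q))
    (x : ℝ) : prim p x ≤ prim q x + (t - s) := by
  obtain ⟨g, hg, hpg⟩ := exists_prim_eq_max (p - q) (sub_nonneg.2 hst)
  simp only [prim_sub] at hg
  have hgb : prim g b = 0 := by
    rw [hg, hp.1.1, hq.1.1]
    exact max_eq_right (by linarith)
  have h1 : p - g ∈ tvBall a b t := by
    refine ⟨by rw [prim_sub, hp.1.1, hgb, sub_zero], fun y => ?_⟩
    rw [prim_sub, hg, abs_le]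
    have h3 := abs_le.1 (hp.1.2 y)
    have h4 := abs_le.1 (hq.1.2 y)
    rcases max_cases (prim p y - prim q y - (t - s)) 0 with ⟨h, _⟩ | ⟨h, _⟩ <;> rw [h] <;>
      constructor <;> linarith
  have h2 : q + g ∈ tvBall a b s := by
    refine ⟨by rw [prim_add, hq.1.1, hgb, add_zero], fun y => ?_⟩
    rw [prim_add, hg, abs_le]
    have h3 := abs_le.1 (hp.1.2 y)
    have h4 := abs_le.1 (hq.1.2 y)
    rcases max_cases (prim p y - prim q y - (t - s)) 0 with ⟨h, _⟩ | ⟨h, _⟩ <;> rw [h] <;>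
      constructor <;> linarith
  have h3 := hp.2 _ h1
  have h4 := hq.2 _ h2
  rw [inner_sub_right] at h3
  rw [inner_add_right] at h4
  rw [inner_sub_left] at hpg
  rw [inner_sub_left u₀ p g] at h3
  rw [inner_sub_left u₀ q g] at h4
  have h5 : ‖g‖ ^ 2 = 0 := le_antisymm (by linarith) (sq_nonneg _)
  have h6 : g = 0 := by simpa using h5
  have h7 := hg x
  rw [h6, prim_zero] at h7
  have := le_max_left (prim p x - prim q x - (t - s)) 0
  linarith

lemma abs_prim_sub_le {u₀ p q : L2Ioo a b} {s t : ℝ} (hst : s ≤ t)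
    (hp : p ∈ normalFace (tvBall a b t) (u₀ - p)) (hq : q ∈ normalFace (tvBall a b s) (u₀ - q))
    (x : ℝ) : |prim p x - prim q x| ≤ t - s := by
  have h1 := prim_le_prim_add hst hp hq x
  have hp' := neg_mem_normalFace hp
  have hq' := neg_mem_normalFace hq
  rw [neg_sub'] at hp' hq'
  have h2 := prim_le_prim_add hst hp' hq' x
  rw [prim_neg, prim_neg] at h2
  rw [abs_le]
  constructor <;> linarith

lemma implicit_euler {u₀ p q : L2Ioo a b} {s t : ℝ} (hst : s < t)
    (hp : p ∈ normalFace (tvBall a b t) (u₀ - p)) (hq : q ∈ normalFace (tvBall a b s) (u₀ - q)) :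
    (t - s)⁻¹ • ((u₀ - q) - (u₀ - p)) ∈ normalFace (tvBall a b 1) (u₀ - p) := by
  have hts : 0 < t - s := sub_pos.2 hst
  rw [sub_sub_sub_cancel_left]
  refine ⟨⟨by rw [prim_smul, prim_sub, hp.1.1, hq.1.1]; simp, fun x => ?_⟩, fun r hr => ?_⟩
  · rw [prim_smul, prim_sub, abs_mul, abs_of_pos (inv_pos.2 hts), inv_mul_le_one₀ hts]
    exact abs_prim_sub_le hst.le hp hq x
  · have h1 := add_mem_tvBall hq.1 (smul_mem_tvBall hts.le hr)
    rw [mul_one, add_sub_cancel] at h1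
    have h2 := hp.2 _ h1
    rw [inner_add_right, inner_smul_right] at h2
    rw [inner_smul_right, inner_sub_right, le_inv_mul_iff₀ hts]
    linarith

lemma zero_mem_normalFace_tvBall_zero (w : L2Ioo a b) : 0 ∈ normalFace (tvBall a b 0) w := by
  refine ⟨zero_mem_tvBall le_rfl, fun q hq => ?_⟩
  rw [eq_zero_of_prim_eq_zero fun x => abs_nonpos_iff.1 (hq.2 x)]

lemma eq_zero_of_mem_tvBall_zero {p : L2Ioo a b} (hp : p ∈ tvBall a b 0) : p = 0 :=
  eq_zero_of_prim_eq_zero fun x => abs_nonpos_iff.1 (hp.2 x)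

/-- The functions on which `p ↦ ⟪f, p⟫` is bounded over `tvBall a b 1` are dense in `L²`. -/
lemma dense_bounded_on_tvBall :
    Dense {f : L2Ioo a b | ∃ C, ∀ p ∈ tvBall a b 1, inner ℝ f p ≤ C} := by
  have h : Dense (Submodule.span ℝ (range (stepFn a b)) : Set (L2Ioo a b)) := by
    rw [Submodule.dense_iff_topologicalClosure_eq_top, Submodule.topologicalClosure_eq_top_iff,
      Submodule.eq_bot_iff]
    intro u hu
    refine eq_zero_of_prim_eq_zero fun x => ?_
    rw [prim_eq_inner]
    exact hu _ (Submodule.subset_span ⟨x, rfl⟩)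
  refine h.mono fun f hf => ?_
  suffices h : ∃ C, ∀ p ∈ tvBall a b 1, |inner ℝ f p| ≤ C by
    obtain ⟨C, hC⟩ := h
    exact ⟨C, fun p hp => (le_abs_self _).trans (hC p hp)⟩
  induction hf using Submodule.span_induction with
  | mem f hf =>
    obtain ⟨x, rfl⟩ := hf
    exact ⟨1, fun p hp => by rw [← prim_eq_inner]; exact hp.2 x⟩
  | zero => exact ⟨0, fun p _ => by simp⟩
  | add f g _ _ hf hg =>
    obtain ⟨C, hC⟩ := hf
    obtain ⟨D, hD⟩ := hg
    refine ⟨C + D, fun p hp => ?_⟩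
    rw [inner_add_left]
    exact (abs_add_le _ _).trans (add_le_add (hC p hp) (hD p hp))
  | smul c f _ hf =>
    obtain ⟨C, hC⟩ := hf
    refine ⟨|c| * C, fun p hp => ?_⟩
    rw [inner_smul_left, abs_mul]
    exact mul_le_mul_of_nonneg_left (hC p hp) (abs_nonneg _)

lemma tendsto_dual_zero {u₀ : L2Ioo a b} {P : ℝ → L2Ioo a b}
    (hP : ∀ t, 0 ≤ t → P t ∈ normalFace (tvBall a b t) (u₀ - P t)) :
    Tendsto P (𝓝[>] 0) (𝓝 0) := by
  rw [tendsto_zero_iff_norm_tendsto_zero]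
  refine tendsto_order.2 ⟨fun c hc => Eventually.of_forall fun t => hc.trans_le (norm_nonneg _),
    fun ε hε => ?_⟩
  obtain ⟨f, ⟨C, hC⟩, hf⟩ := Metric.dense_iff.1 (dense_bounded_on_tvBall (a := a) (b := b)) u₀
    (ε / 2) (half_pos hε) |>.imp fun f h => h.symm
  rw [mem_ball_iff_norm'] at hf
  have hlim : Tendsto (fun t => t * C) (𝓝[>] 0) (𝓝 0) := by
    have : Continuous fun t => t * C := by fun_prop
    simpa using (this.tendsto 0).mono_left nhdsWithin_le_nhds
  filter_upwards [hlim.eventually (gt_mem_nhds (show 0 < ε ^ 2 / 2 by positivity)),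
    self_mem_nhdsWithin] with t ht ht0
  have ht0 : 0 < t := ht0
  have hp := hP t ht0.le
  have h1 := inner_nonneg_of_mem_normalFace ht0.le hp
  have h2 : inner ℝ f (P t) ≤ t * C := by
    have h3 := smul_mem_tvBall (inv_nonneg.2 ht0.le) hp.1
    rw [inv_mul_cancel₀ ht0.ne'] at h3
    have := hC _ h3
    rwa [inner_smul_right, inv_mul_le_iff₀ ht0] at this
  have h3 : inner ℝ (u₀ - f) (P t) ≤ ‖u₀ - f‖ * ‖P t‖ := real_inner_le_norm _ _
  rw [inner_sub_left, real_inner_self_eq_norm_sq] at h1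
  rw [inner_sub_left] at h3
  by_contra! hle
  nlinarith [norm_nonneg (P t), norm_nonneg (u₀ - f)]

/-- The functions `u₀ - P t`, with `P t` the solutions of the dual problems, form the flow. -/
theorem isTVFlow_of_dual (hab : a < b) {u₀ : L2Ioo a b} {P : ℝ → L2Ioo a b}
    (hP : ∀ t, 0 ≤ t → P t ∈ normalFace (tvBall a b t) (u₀ - P t)) :
    IsTVFlow a b u₀ fun t => u₀ - P t := by
  have hP0 : P 0 = 0 := eq_zero_of_mem_tvBall_zero (hP 0 le_rfl).1
  obtain ⟨h1, h2, h3⟩ := evolution_of_implicit_euler (A := normalFace (tvBall a b 1))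
    (u := fun t => u₀ - P t) (fun x y p hp q hq => normalFace_monotone hp hq)
    (isClosed_normalFace (isClosed_tvBall 1)) (convex_normalFace (convex_tvBall 1))
    (fun s t hs hst => implicit_euler hst (hP t (hs.trans hst.le)) (hP s hs))
  refine ⟨by simp [hP0], fun t ht => ?_, h1, ?_⟩
  · rcases (show 0 ≤ t from ht).eq_or_lt with rfl | ht
    · refine continuousWithinAt_Ioi_iff_Ici.1 ?_
      refine ContinuousWithinAt.sub continuousWithinAt_const ?_
      rw [ContinuousWithinAt, hP0]
      exact tendsto_dual_zero hP
    · exact (h2.continuousAt (Ioi_mem_nhds ht)).continuousWithinAt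
  · filter_upwards [h3] with t ht ht0
    obtain ⟨p, hp, hpA⟩ := ht ht0
    exact ⟨p, hp, normalFace_subset_tvSubdiff hab _ hpA⟩

theorem IsTVFlow.eq {u₀ : L2Ioo a b} {u v : ℝ → L2Ioo a b} (hu : IsTVFlow a b u₀ u)
    (hv : IsTVFlow a b u₀ v) {t : ℝ} (ht : 0 ≤ t) : u t = v t :=
  eq_of_monotone_evolution tvSubdiff_monotone (hu.initial.trans hv.initial.symm)
    hu.continuousOn hv.continuousOn hu.absolutelyContinuous hv.absolutelyContinuous
    hu.evolution hv.evolution ht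

lemma inv_smul_mem_normalFace {u₀ p : L2Ioo a b} {t : ℝ} (ht : 0 < t)
    (hp : p ∈ normalFace (tvBall a b t) (u₀ - p)) :
    t⁻¹ • p ∈ normalFace (tvBall a b 1) (u₀ - p) := by
  have := implicit_euler ht hp (q := 0) (zero_mem_normalFace_tvBall_zero _)
  simpa using this

lemma tvEnergy_eq (u₀ u : L2Ioo a b) (t : ℝ) :
    tvEnergy a b u₀ t u = totalVar a b u + ENNReal.ofReal (1 / (2 * t) * ‖u - u₀‖ ^ 2) := by
  rw [tvEnergy, ← real_inner_self_eq_norm_sq, L2.inner_def]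
  congr 3
  refine integral_congr_ae ?_
  filter_upwards [Lp.coeFn_sub u u₀] with x hx
  rw [hx]
  simp [sq]

lemma tvEnergy_add_le (hab : a < b) {u₀ p : L2Ioo a b} {t : ℝ} (ht : 0 < t)
    (hp : p ∈ normalFace (tvBall a b t) (u₀ - p)) (v : L2Ioo a b) :
    tvEnergy a b u₀ t (u₀ - p) + ENNReal.ofReal (1 / (2 * t) * ‖v - (u₀ - p)‖ ^ 2) ≤
      tvEnergy a b u₀ t v := by
  have hr := inv_smul_mem_normalFace ht hp
  have h0 := inner_nonneg_of_mem_normalFace zero_le_one hr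
  rw [tvEnergy_eq, tvEnergy_eq, totalVar_eq_of_mem_normalFace hab hr,
    ← ENNReal.ofReal_add h0 (by positivity), ← ENNReal.ofReal_add (by positivity) (by positivity)]
  refine le_trans (le_trans (ENNReal.ofReal_le_ofReal ?_) (ENNReal.ofReal_add_le
    (p := inner ℝ v (t⁻¹ • p)) (q := 1 / (2 * t) * ‖v - u₀‖ ^ 2)))
    (add_le_add_left (ofReal_inner_le_totalVar hab v hr.1) _)
  have e1 : v - u₀ = (v - (u₀ - p)) - p := by abel
  have e2 : inner ℝ v p = inner ℝ (v - (u₀ - p)) p + inner ℝ (u₀ - p) p := by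
    rw [← inner_add_left]
    congr 1
    abel
  have e3 : u₀ - p - u₀ = -p := by abel
  rw [e1, norm_sub_sq_real (v - (u₀ - p)) p, inner_smul_right, inner_smul_right, e2, e3, norm_neg]
  apply le_of_eq
  field_simp
  ring

theorem isMinOn_tvEnergy (hab : a < b) {u₀ p : L2Ioo a b} {t : ℝ} (ht : 0 < t)
    (hp : p ∈ normalFace (tvBall a b t) (u₀ - p)) :
    IsMinOn (tvEnergy a b u₀ t) univ (u₀ - p) ∧
      ∀ v : L2Ioo a b, IsMinOn (tvEnergy a b u₀ t) univ v → v = u₀ - p := by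
  refine ⟨fun v _ => le_self_add.trans (tvEnergy_add_le hab ht hp v), fun v hv => ?_⟩
  have h1 := (tvEnergy_add_le hab ht hp v).trans (hv (mem_univ (u₀ - p)))
  have hr := inv_smul_mem_normalFace ht hp
  have hfin : tvEnergy a b u₀ t (u₀ - p) ≠ ⊤ := by
    rw [tvEnergy_eq, totalVar_eq_of_mem_normalFace hab hr]
    simp
  have h2 : ENNReal.ofReal (1 / (2 * t) * ‖v - (u₀ - p)‖ ^ 2) ≤ 0 :=
    ENNReal.le_of_add_le_add_left hfin (by rwa [add_zero])
  have h3 := ENNReal.ofReal_eq_zero.1 (le_antisymm h2 zero_le)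
  have h4 : 0 < 1 / (2 * t) := by positivity
  have h5 : ‖v - (u₀ - p)‖ ^ 2 = 0 := le_antisymm (by nlinarith) (sq_nonneg _)
  rw [← sub_eq_zero]
  simpa using h5

/-- Where the primitive of `p` stays below the upper constraint, `w` is nondecreasing. -/
lemma le_of_prim_lt {w p : L2Ioo a b} {t : ℝ} (hp : p ∈ normalFace (tvBall a b t) w)
    {y z α β : ℝ} (hay : a ≤ y) (hyz : y < z) (hzb : z ≤ b) (hlt : ∀ x ∈ Icc y z, prim p x < t)
    (hy : HasDerivAt (prim w) α y) (hz : HasDerivAt (prim w) β z) : α ≤ β := by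
  obtain ⟨m, hm, hmax⟩ := isCompact_Icc.exists_isMaxOn (nonempty_Icc.2 hyz.le)
    (continuous_prim p).continuousOn
  have hmt : 0 < t - prim p m := sub_pos.2 (hlt m hm)
  have key : ∀ h, 0 < h → h < (z - y) / 2 → h < t - prim p m →
      prim w (y + h) - prim w y ≤ prim w z - prim w (z - h) := by
    intro h h0 h1 h2
    have hmem : ∀ x, y ≤ x → x ≤ z → x ∈ Icc a b := fun x h3 h4 => ⟨hay.trans h3, h4.trans hzb⟩
    set g := (stepFn a b (y + h) - stepFn a b y) - (stepFn a b z - stepFn a b (z - h))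
    have hg : ∀ x ∈ Icc a b,
        prim g x = (min x (y + h) - min x y) - (min x z - min x (z - h)) := by
      intro x hx
      simp only [g, prim_sub]
      rw [prim_stepFn (hmem _ (by linarith) (by linarith)) hx,
        prim_stepFn (hmem _ (by linarith) (by linarith)) hx,
        prim_stepFn (hmem _ (by linarith) (by linarith)) hx,
        prim_stepFn (hmem _ (by linarith) (by linarith)) hx]
      ring
    have hab : a ≤ b := by linarith
    have hgz : ∀ x ∈ Icc a b, x ∉ Icc y z → prim g x = 0 := by
      intro x hx hxn
      rw [hg x hx]
      rw [mem_Icc, not_and_or, not_le, not_le] at hxn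
      rcases hxn with hxn | hxn
      · rw [min_eq_left, min_eq_left, min_eq_left, min_eq_left] <;> linarith
      · rw [min_eq_right, min_eq_right, min_eq_right, min_eq_right] <;> linarith
    have hgb : prim g b = 0 := by
      rw [hg b (right_mem_Icc.2 hab), min_eq_right, min_eq_right, min_eq_right, min_eq_right] <;>
        linarith
    have hmem : p + g ∈ tvBall a b t := by
      refine ⟨by rw [prim_add, hp.1.1, hgb, add_zero], fun x => ?_⟩
      rw [prim_add]
      have hpx := abs_le.1 (hp.1.2 x)
      by_cases hx : x ∈ Icc y z
      · have hx' : x ∈ Icc a b := ⟨hay.trans hx.1, hx.2.trans hzb⟩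
        have h3 : 0 ≤ prim g x ∧ prim g x ≤ h := by
          rw [hg x hx', min_eq_right hx.1, min_eq_left hx.2]
          rcases min_cases x (y + h) with ⟨h4, h5⟩ | ⟨h4, h5⟩ <;>
            rcases min_cases x (z - h) with ⟨h6, h7⟩ | ⟨h6, h7⟩ <;> rw [h4, h6] <;>
            constructor <;> linarith [hx.1, hx.2]
        have h4 : prim p x ≤ prim p m := hmax hx
        rw [abs_le]
        constructor <;> linarith
      · have h3 : prim g x = 0 := by
          rcases le_total x a with hxa | hxa
          · exact prim_of_le g hxa
          rcases le_total b x with hxb | hxb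
          · rw [prim_of_ge g hxb, hgb]
          · exact hgz x ⟨hxa, hxb⟩ hx
        rw [h3, add_zero]
        exact hp.1.2 x
    have h3 := hp.2 _ hmem
    simp only [g, inner_add_right, inner_sub_right] at h3
    simp only [real_inner_comm _ w, ← prim_eq_inner] at h3
    linarith
  have hy' := hasDerivAt_iff_tendsto_slope_zero.1 hy
  have hz' := hasDerivAt_iff_tendsto_slope_zero.1 hz
  have h1 : Tendsto (fun h => h⁻¹ • (prim w (y + h) - prim w y)) (𝓝[>] 0) (𝓝 α) :=
    hy'.mono_left (nhdsWithin_mono _ fun _ hx => ne_of_gt hx)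
  have hneg : Tendsto (fun h : ℝ => -h) (𝓝[>] 0) (𝓝[≠] 0) := by
    refine tendsto_nhdsWithin_iff.2 ⟨?_, ?_⟩
    · have : Continuous fun h : ℝ => -h := continuous_neg
      simpa using (this.tendsto 0).mono_left nhdsWithin_le_nhds
    · filter_upwards [self_mem_nhdsWithin] with h hh
      exact neg_ne_zero.2 (ne_of_gt hh)
  have h2 := hz'.comp hneg
  refine le_of_tendsto_of_tendsto h1 h2 ?_
  filter_upwards [Ioo_mem_nhdsGT (show 0 < (z - y) / 2 by linarith), Ioo_mem_nhdsGT hmt]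
    with h hh hh'
  have h3 := key h hh.1 hh.2 hh'.2
  simp only [Function.comp_apply, smul_eq_mul, inv_neg]
  rw [← sub_eq_add_neg, neg_mul, ← mul_neg, neg_sub]
  exact mul_le_mul_of_nonneg_left h3 (inv_nonneg.2 hh.1.le)

/-- A function that is nondecreasing on a subset of full measure of an open set is almost
everywhere equal to a nondecreasing function. -/
lemma aeMonotoneOn_of_forall_mem {F : ℝ → ℝ} {C S : Set ℝ} (hC : IsOpen C)
    (hS : ∀ᵐ x, x ∈ S) (h : ∀ y ∈ S ∩ C, ∀ z ∈ S ∩ C, y < z → F y ≤ F z) : AEMonotoneOn F C := by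
  have hmono : MonotoneOn F (S ∩ C) := by
    intro y hy z hz hyz
    rcases hyz.eq_or_lt with rfl | hyz
    · exact le_rfl
    · exact h y hy z hz hyz
  have hdense : ∀ c d, c < d → ∃ x ∈ S, x ∈ Ioo c d := by
    intro c d hcd
    by_contra! hn
    have h1 : volume (Ioo c d) = 0 := measure_mono_null (fun x hx hxS => hn x hxS hx) hS
    rw [Real.volume_Ioo, ENNReal.ofReal_eq_zero] at h1
    linarith
  have hnear : ∀ x ∈ C, (∃ y ∈ S ∩ C, y ≤ x) ∧ ∃ z ∈ S ∩ C, x ≤ z := by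
    intro x hx
    obtain ⟨l, r, hxI, hI⟩ := mem_nhds_iff_exists_Ioo_subset.1 (hC.mem_nhds hx)
    obtain ⟨y, hyS, hy⟩ := hdense l x hxI.1
    obtain ⟨z, hzS, hz⟩ := hdense x r hxI.2
    exact ⟨⟨y, ⟨hyS, hI ⟨hy.1, hy.2.trans hxI.2⟩⟩, hy.2.le⟩,
      ⟨z, ⟨hzS, hI ⟨hxI.1.trans hz.1, hz.2⟩⟩, hz.1.le⟩⟩
  have hbdd : ∀ x ∈ C, BddAbove (F '' {y ∈ S ∩ C | y ≤ x}) := by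
    intro x hx
    obtain ⟨z, hz, hxz⟩ := (hnear x hx).2
    refine ⟨F z, ?_⟩
    rintro _ ⟨y, ⟨hy, hyx⟩, rfl⟩
    exact hmono hy hz (hyx.trans hxz)
  refine ⟨fun x => sSup (F '' {y ∈ S ∩ C | y ≤ x}), fun x hx z hz hxz => ?_, ?_⟩
  · obtain ⟨y, hy, hyx⟩ := (hnear x hx).1
    exact csSup_le_csSup (hbdd z hz) ⟨F y, y, ⟨hy, hyx⟩, rfl⟩
      (image_mono fun y hy => ⟨hy.1, hy.2.trans hxz⟩)
  · refine (ae_restrict_iff' hC.measurableSet).2 ?_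
    filter_upwards [hS] with x hxS hxC
    have hmem : F x ∈ F '' {y ∈ S ∩ C | y ≤ x} := ⟨x, ⟨⟨hxS, hxC⟩, le_rfl⟩, rfl⟩
    refine (IsGreatest.csSup_eq (s := F '' {y ∈ S ∩ C | y ≤ x}) ⟨hmem, ?_⟩).symm
    rintro _ ⟨y, ⟨hy, hyx⟩, rfl⟩
    exact hmono hy ⟨hxS, hxC⟩ hyx

lemma AEMonotoneOn.congr_mono {f g : ℝ → ℝ} {C I : Set ℝ} (hf : AEMonotoneOn f C) (hI : I ⊆ C)
    (h : ∀ᵐ x ∂volume.restrict I, g x = f x) : AEMonotoneOn g I := by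
  obtain ⟨k, hk, hfk⟩ := hf
  refine ⟨k, hk.mono hI, ?_⟩
  filter_upwards [h, ae_restrict_of_ae_restrict_of_subset hI hfk] with x h1 h2
  rw [h1, h2]

lemma AEMonotoneOn.neg {f : ℝ → ℝ} {I : Set ℝ} (hf : AEMonotoneOn f I) :
    AEAntitoneOn (fun x => -f x) I := by
  obtain ⟨k, hk, hfk⟩ := hf
  exact ⟨fun x => -k x, hk.neg, hfk.mono fun x hx => congr_arg Neg.neg hx⟩

/-- Two points of a connected component of `U` span an interval contained in `U`. -/
lemma Icc_subset_of_mem_connectedComponentIn {U : Set ℝ} {x y z : ℝ}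
    (hy : y ∈ connectedComponentIn U x) (hz : z ∈ connectedComponentIn U x) : Icc y z ⊆ U :=
  (isPreconnected_connectedComponentIn.ordConnected.out hy hz).trans (connectedComponentIn_subset _ _)

lemma zeroExt_ae_eq (u : L2Ioo a b) : ∀ᵐ x ∂volume.restrict (Ioo a b), zeroExt u x = u x :=
  (ae_restrict_iff' measurableSet_Ioo).2 (Eventually.of_forall fun x hx => by simp [zeroExt, hx])

lemma zeroExt_neg_ae_eq (u : L2Ioo a b) : ∀ᵐ x, zeroExt (-u) x = -zeroExt u x := by
  filter_upwards [ae_eq_of_zeroExt (Lp.coeFn_neg u)] with x hx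
  rw [hx]
  by_cases h : x ∈ Ioo a b <;> simp [zeroExt, h]

/-- On an interval where the lower constraint is active, `w` is nondecreasing. -/
lemma aeMonotoneOn_of_prim_eq_neg {w p : L2Ioo a b} {t : ℝ} (ht : 0 < t)
    (hp : p ∈ normalFace (tvBall a b t) w) {I : Set ℝ} (hI : I.OrdConnected)
    (hsub : I ⊆ {x ∈ Ioo a b | prim p x = -t}) : AEMonotoneOn (zeroExt w) I := by
  rcases I.eq_empty_or_nonempty with rfl | ⟨x₀, hx₀⟩
  · exact ⟨0, by simp [MonotoneOn], by simp⟩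
  set U := Ioo a b ∩ {x | prim p x < t}
  have hU : IsOpen U := isOpen_Ioo.inter (isOpen_lt (continuous_prim p) continuous_const)
  have hIU : I ⊆ U := fun x hx => ⟨(hsub hx).1, by
    have := (hsub hx).2
    show prim p x < t
    linarith⟩
  have hIC : I ⊆ connectedComponentIn U x₀ :=
    hI.isPreconnected.subset_connectedComponentIn hx₀ hIU
  refine AEMonotoneOn.congr_mono (f := zeroExt w) ?_ hIC (Eventually.of_forall fun _ => rfl)
  refine aeMonotoneOn_of_forall_mem hU.connectedComponentIn (ae_hasDerivAt_prim w) ?_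
  rintro y ⟨hyd, hyC⟩ z ⟨hzd, hzC⟩ hyz
  have hyz' := Icc_subset_of_mem_connectedComponentIn hyC hzC
  exact le_of_prim_lt hp (connectedComponentIn_subset _ _ hyC).1.1.le hyz
    (connectedComponentIn_subset _ _ hzC).1.2.le (fun x hx => (hyz' hx).2) hyd hzd

/-- On an interval where the upper constraint is active, `w` is nonincreasing. -/
lemma aeAntitoneOn_of_prim_eq {w p : L2Ioo a b} {t : ℝ} (ht : 0 < t)
    (hp : p ∈ normalFace (tvBall a b t) w) {I : Set ℝ} (hI : I.OrdConnected)
    (hsub : I ⊆ {x ∈ Ioo a b | prim p x = t}) : AEAntitoneOn (zeroExt w) I := by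
  have h1 := aeMonotoneOn_of_prim_eq_neg ht (neg_mem_normalFace hp) hI fun x hx =>
    ⟨(hsub hx).1, by rw [prim_neg, (hsub hx).2]⟩
  have h2 := (h1.congr_mono Subset.rfl (g := fun x => -zeroExt w x)
    (ae_restrict_of_ae ((zeroExt_neg_ae_eq w).mono fun x hx => hx.symm))).neg
  simpa using h2

/-- Where no constraint is active, `w` is constant. -/
lemma exists_const_of_abs_prim_lt {w p : L2Ioo a b} {t : ℝ}
    (hp : p ∈ normalFace (tvBall a b t) w) {U : Set ℝ} (hU : U ⊆ Ioo a b)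
    (hlt : ∀ x ∈ U, |prim p x| < t) (x : ℝ) :
    ∃ c, ∀ᵐ y ∂volume.restrict (connectedComponentIn U x), w y = c := by
  set C := connectedComponentIn U x
  have hCU : C ⊆ U := connectedComponentIn_subset U x
  have hmeas : MeasurableSet C :=
    isPreconnected_connectedComponentIn.ordConnected.measurableSet
  have key : ∀ y ∈ C, ∀ z ∈ C, HasDerivAt (prim w) (zeroExt w y) y →
      HasDerivAt (prim w) (zeroExt w z) z → y < z → zeroExt w y = zeroExt w z := by
    intro y hy z hz hyd hzd hyz
    have hyz' := Icc_subset_of_mem_connectedComponentIn hy hz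
    have hya := (hU (hCU hy)).1.le
    have hzb := (hU (hCU hz)).2.le
    have hpn : prim (-w) = fun x => -prim w x := funext (prim_neg w)
    refine le_antisymm (le_of_prim_lt hp hya hyz hzb
      (fun x hx => (abs_lt.1 (hlt x (hyz' hx))).2) hyd hzd) (neg_le_neg_iff.1 ?_)
    refine le_of_prim_lt (neg_mem_normalFace hp) hya hyz hzb (fun x hx => ?_)
      (by rw [hpn]; exact hyd.neg) (by rw [hpn]; exact hzd.neg)
    rw [prim_neg]
    linarith [(abs_lt.1 (hlt x (hyz' hx))).1]
  have hae := ae_restrict_of_ae_restrict_of_subset (hCU.trans hU) (zeroExt_ae_eq w)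
  by_cases hne : ∃ y ∈ C, HasDerivAt (prim w) (zeroExt w y) y
  · obtain ⟨y, hyC, hyd⟩ := hne
    refine ⟨zeroExt w y, ?_⟩
    filter_upwards [hae, ae_restrict_of_ae (ae_hasDerivAt_prim w), ae_restrict_mem hmeas]
      with z hz hzd hzC
    rw [← hz]
    rcases lt_trichotomy y z with h | rfl | h
    · exact (key y hyC z hzC hyd hzd h).symm
    · rfl
    · exact key z hzC y hyC hzd hyd h
  · refine ⟨0, ?_⟩
    filter_upwards [ae_restrict_of_ae (ae_hasDerivAt_prim w), ae_restrict_mem hmeas] with z hzd hzC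
    exact absurd ⟨z, hzC, hzd⟩ hne

/-- The data term is fitted exactly where a constraint is active. -/
lemma sub_ae_eq_of_abs_prim_eq {u₀ p : L2Ioo a b} {t : ℝ} (hp : p ∈ tvBall a b t) :
    ∀ᵐ x ∂volume.restrict (Ioo a b), |prim p x| = t → (u₀ - p : L2Ioo a b) x = u₀ x := by
  filter_upwards [Lp.coeFn_sub u₀ p, ae_restrict_of_ae (ae_eq_zero_of_abs_prim_eq hp.2),
    zeroExt_ae_eq p] with x h1 h2 h3 h4
  rw [h1, Pi.sub_apply, ← h3, h2 h4, sub_zero]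

end

theorem mainTheorem4 (a b : ℝ) (hab : a < b) (u₀ : L2Ioo a b) :
    (∃ u : ℝ → L2Ioo a b, IsTVFlow a b u₀ u) ∧
    ∀ u : ℝ → L2Ioo a b, IsTVFlow a b u₀ u →
      (∀ t : ℝ, 0 < t →
        IsMinOn (tvEnergy a b u₀ t) univ (u t) ∧
        ∀ v : L2Ioo a b, IsMinOn (tvEnergy a b u₀ t) univ v → v = u t) ∧
      ∃ Ep Em : ℝ → Set ℝ,
        AntitoneOn Ep (Ioi 0) ∧ AntitoneOn Em (Ioi 0) ∧
        ∀ t : ℝ, 0 < t →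
          IsClosed (Ep t) ∧ IsClosed (Em t) ∧
          Ep t ⊆ Ioo a b ∧ Em t ⊆ Ioo a b ∧ Disjoint (Ep t) (Em t) ∧
          (∀ᵐ x ∂volume.restrict (Ep t ∪ Em t), u t x = u₀ x) ∧
          (∀ I : Set ℝ, I.OrdConnected → I ⊆ Ep t → AEMonotoneOn u₀ I) ∧
          (∀ I : Set ℝ, I.OrdConnected → I ⊆ Em t → AEAntitoneOn u₀ I) ∧
          (∀ x ∈ Ioo a b \ (Ep t ∪ Em t), ∃ c : ℝ,
            ∀ᵐ y ∂volume.restrict (connectedComponentIn (Ioo a b \ (Ep t ∪ Em t)) x),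
              u t y = c) := by
  have hex : ∀ t : ℝ, ∃ p : L2Ioo a b, 0 ≤ t → p ∈ normalFace (tvBall a b t) (u₀ - p) := by
    intro t
    by_cases ht : 0 ≤ t
    · obtain ⟨p, hp⟩ := exists_mem_normalFace_sub u₀ ht
      exact ⟨p, fun _ => hp⟩
    · exact ⟨0, fun h => absurd h ht⟩
  choose P hP using hex
  have hflow := isTVFlow_of_dual hab hP
  refine ⟨⟨_, hflow⟩, fun u hu => ?_⟩
  have hut : ∀ t, 0 < t → u t = u₀ - P t := fun t ht => hu.eq hflow ht.le
  refine ⟨fun t ht => by rw [hut t ht]; exact isMinOn_tvEnergy hab ht (hP t ht.le),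
    fun t => {x | prim (P t) x = -t}, fun t => {x | prim (P t) x = t}, ?_, ?_, ?_⟩
  · intro s hs t ht hst x hx
    have hs : 0 < s := hs
    have ht : 0 < t := ht
    have hx : prim (P t) x = -t := hx
    have h1 := (abs_le.1 (abs_prim_sub_le hst (hP t ht.le) (hP s hs.le) x)).1
    have h2 := (abs_le.1 ((hP s hs.le).1.2 x)).1
    show prim (P s) x = -s
    linarith
  · intro s hs t ht hst x hx
    have hs : 0 < s := hs
    have ht : 0 < t := ht
    have hx : prim (P t) x = t := hx
    have h1 := (abs_le.1 (abs_prim_sub_le hst (hP t ht.le) (hP s hs.le) x)).2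
    have h2 := (abs_le.1 ((hP s hs.le).1.2 x)).2
    show prim (P s) x = s
    linarith
  · intro t ht
    have hp := hP t ht.le
    rw [hut t ht]
    have hIoo : ∀ x, prim (P t) x ≠ 0 → x ∈ Ioo a b := by
      intro x hx
      refine ⟨?_, ?_⟩
      · by_contra! h
        exact hx (prim_of_le _ h)
      · by_contra! h
        exact hx ((prim_of_ge _ h).trans hp.1.1)
    have hEp : ({x | prim (P t) x = -t} : Set ℝ) ⊆ Ioo a b := fun x hx =>
      hIoo x (by rw [show prim (P t) x = -t from hx]; exact neg_ne_zero.2 ht.ne')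
    have hEm : ({x | prim (P t) x = t} : Set ℝ) ⊆ Ioo a b := fun x hx =>
      hIoo x (by rw [show prim (P t) x = t from hx]; exact ht.ne')
    have hcp : IsClosed {x | prim (P t) x = -t} :=
      isClosed_eq (continuous_prim _) continuous_const
    have hcm : IsClosed {x | prim (P t) x = t} :=
      isClosed_eq (continuous_prim _) continuous_const
    have hfit := ae_restrict_of_ae_restrict_of_subset (union_subset hEp hEm)
      (sub_ae_eq_of_abs_prim_eq (u₀ := u₀) hp.1)
    have hfit : ∀ᵐ x ∂volume.restrict ({x | prim (P t) x = -t} ∪ {x | prim (P t) x = t}),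
        (u₀ - P t : L2Ioo a b) x = u₀ x := by
      filter_upwards [hfit, ae_restrict_mem (hcp.union hcm).measurableSet] with x hx hxE
      refine hx ?_
      rcases hxE with hxE | hxE
      · rw [show prim (P t) x = -t from hxE, abs_neg, abs_of_pos ht]
      · rw [show prim (P t) x = t from hxE, abs_of_pos ht]
    have hrep : ∀ᵐ x ∂volume.restrict ({x | prim (P t) x = -t} ∪ {x | prim (P t) x = t}),
        u₀ x = zeroExt (u₀ - P t) x := by
      filter_upwards [hfit, ae_restrict_of_ae_restrict_of_subset (union_subset hEp hEm)
        (zeroExt_ae_eq (u₀ - P t))] with x h1 h2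
      rw [h2, h1]
    refine ⟨hcp, hcm, hEp, hEm, ?_, hfit, fun I hI hIE => ?_, fun I hI hIE => ?_, fun x _ => ?_⟩
    · refine disjoint_left.2 fun x hx hx' => ?_
      have h1 : prim (P t) x = -t := hx
      have h2 : prim (P t) x = t := hx'
      linarith
    · exact (aeMonotoneOn_of_prim_eq_neg ht hp hI fun x hx => ⟨hEp (hIE hx), hIE hx⟩).congr_mono
        Subset.rfl (ae_restrict_of_ae_restrict_of_subset (hIE.trans subset_union_left) hrep)
    · obtain ⟨k, hk, hfk⟩ :=
        aeAntitoneOn_of_prim_eq ht hp hI fun x hx => ⟨hEm (hIE hx), hIE hx⟩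
      refine ⟨k, hk, ?_⟩
      filter_upwards [hfk,
        ae_restrict_of_ae_restrict_of_subset (hIE.trans subset_union_right) hrep] with x h1 h2
      rw [h2, h1]
    · refine exists_const_of_abs_prim_lt hp sdiff_subset (fun y hy => ?_) x
      refine lt_of_le_of_ne (hp.1.2 y) fun h => hy.2 ?_
      rcases eq_or_eq_neg_of_abs_eq h with h | h
      · exact Or.inr h
      · exact Or.inl h
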